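/- A $0$-$1$ word is a map $\mu\colon I\to\{0,1\}$, where $I\subseteq\mathbb Z$ is one of $\{0,\dots,n-1\}$ ($n\ge 0$), $\mathbb N$, $\mathbb N^*=\{0,-1,-2,\dots\}$ or $\mathbb Z$. Its factors are the finite words $\mu(p)\mu(p+1)\cdots\mu(p+k-1)$ with $k\ge 0$ and $p,\dots,p+k-1\in I$. The word $\mu$ is uniformly recurrent if for every $n\in\mathbb N$ there is $m\in\mathbb N$ such that each factor of $\mu$ of length $n$ is a factor of every factor of $\mu$ of length $m$. It is periodic if there is an integer $p>0$ such that $\mu(i)=\mu(i+p)$ whenever $i,i+p\in I$, and constant if all its letters are equal. The graph $G_\mu$ has vertex set $\{-1,0,\dots,n-1\}$, $\{-1\}\cup\mathbb N$, $\mathbb N^*$ or $\mathbb Z$ according as $I$ is $\{0,\dots,n-1\}$, $\mathbb N$, $\mathbb N^*$ or $\mathbb Z$; for vertices $i<j$, the pair $\{i,j\}$ is an edge if and only if either $\mu(j)=1$ and $j=i+1$, or $\mu(j)=0$ and $j\ne i+1$. The age $\mathrm{Age}(G)$ of a graph $G$ is the class of finite graphs isomorphic to an induced subgraph of $G$. A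 bound of a class $\mathcal C$ of finite graphs that is closed under induced subgraphs and isomorphism is a graph $R\notin\mathcal C$ all of whose proper induced subgraphs belong to $\mathcal C$; bounds are counted up to isomorphism. Theorem. Let $\mu$ be a uniformly recurrent $0$-$1$ word. (1) If $\mu$ is not periodic, then $\mathrm{Age}(G_\mu)$ has infinitely many bounds. (2) If $\mu$ is periodic and not constant, then $\mathrm{Age}(G_\mu)$ has finitely many bounds. -/

import Mathlib

namespace ZeroOne

/-- The four kinds of domains of words: `{0, …, n-1}`, `ℕ`, `ℕ* = {0, -1, -2, …}` and `ℤ`. -/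
inductive WordDomain : Type
  | fin (n : ℕ)
  | nat
  | negNat
  | int

/-- The domain as a set of integers. -/
def WordDomain.positions : WordDomain → Set ℤ
  | .fin n => Set.Ico 0 (n : ℤ)
  | .nat => Set.Ici 0
  | .negNat => Set.Iic 0
  | .int => Set.univ

/-- The vertex set of the graph of a word with the given domain: `{-1, 0, …, n-1}`,
`{-1} ∪ ℕ`, `ℕ*` and `ℤ` respectively. -/
def WordDomain.vertices : WordDomain → Set ℤ
  | .fin n => Set.Ico (-1) (n : ℤ)
  | .nat => Set.Ici (-1)
  | .negNat => Set.Iic 0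
  | .int => Set.univ

/-- Every vertex that is larger than some vertex carries a letter of the word. -/
theorem WordDomain.mem_positions_of_lt {D : WordDomain} {i j : ℤ}
    (hi : i ∈ D.vertices) (hj : j ∈ D.vertices) (hij : i < j) : j ∈ D.positions := by
  cases D <;> simp_all [WordDomain.vertices, WordDomain.positions] <;> omega

/-- A `0`-`1` word: one of the four kinds of domains, with a letter at each of its positions. -/
structure Word : Type where
  dom : WordDomain
  letter : dom.positions → Fin 2

namespace Word

/-- The finite word `w` is a factor of `μ`: it is read on `p, p+1, …, p+|w|-1` for some `p`,
all these positions being in the domain of `μ`. -/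
def IsFactor (w : List (Fin 2)) (μ : Word) : Prop :=
  ∃ p : ℤ, ∀ (k : ℕ) (hk : k < w.length),
    ∃ h : p + (k : ℤ) ∈ μ.dom.positions, μ.letter ⟨p + (k : ℤ), h⟩ = w[k]

/-- For every `n` there is `m` such that each factor of length `n` of `μ` is a factor of every
factor of length `m` of `μ` (`v <:+: w` says that `v` is a factor of the finite word `w`). -/
def UniformlyRecurrent (μ : Word) : Prop :=
  ∀ n : ℕ, ∃ m : ℕ, ∀ v w : List (Fin 2),
    IsFactor v μ → v.length = n → IsFactor w μ → w.length = m → v <:+: w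

/-- `μ` has a positive period: `μ i = μ (i + p)` whenever `i` and `i + p` are in the domain. -/
def Periodic (μ : Word) : Prop :=
  ∃ p : ℕ, 0 < p ∧ ∀ (i : ℤ) (hi : i ∈ μ.dom.positions) (hip : i + (p : ℤ) ∈ μ.dom.positions),
    μ.letter ⟨i, hi⟩ = μ.letter ⟨i + (p : ℤ), hip⟩

/-- All letters of `μ` are equal. -/
def Constant (μ : Word) : Prop :=
  ∃ a : Fin 2, ∀ i : μ.dom.positions, μ.letter i = a

/-- `{i, j}` with `i < j` is an edge: `μ j = 1` and `j = i + 1`, or `μ j = 0` and `j ≠ i + 1`. -/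
def EdgeLT (μ : Word) (i j : ℤ) : Prop :=
  i < j ∧ ∃ h : j ∈ μ.dom.positions,
    (μ.letter ⟨j, h⟩ = 1 ∧ j = i + 1) ∨ (μ.letter ⟨j, h⟩ = 0 ∧ j ≠ i + 1)

/-- The graph `G_μ`. -/
def graph (μ : Word) : SimpleGraph μ.dom.vertices where
  Adj i j := μ.EdgeLT i j ∨ μ.EdgeLT j i
  symm := ⟨fun _ _ h => h.symm⟩
  loopless := ⟨fun i h => by
    rcases h with h | h <;> exact lt_irrefl (i : ℤ) h.1⟩

end Word

/-- A graph together with its vertex set. -/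
abbrev BundledGraph : Type 1 := Σ V : Type, SimpleGraph V

/-- The age of `G`: the class of finite graphs that embed in `G` as induced subgraphs. -/
def age {V : Type} (G : SimpleGraph V) : Set BundledGraph :=
  {H | Finite H.1 ∧ SimpleGraph.IsIndContained H.2 G}

/-- `R` is a bound of the class `C`: `R` is not in `C`, but every proper induced subgraph of `R`
is in `C`. -/
def IsBound (C : Set BundledGraph) (R : BundledGraph) : Prop :=
  R ∉ C ∧ ∀ s : Set R.1, s ≠ Set.univ → (⟨s, R.2.induce s⟩ : BundledGraph) ∈ C

/-- Isomorphism of graphs. -/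
def isoSetoid : Setoid BundledGraph where
  r G H := Nonempty (G.2 ≃g H.2)
  iseqv :=
    { refl := fun _ => ⟨SimpleGraph.Iso.refl⟩
      symm := fun ⟨e⟩ => ⟨e.symm⟩
      trans := fun ⟨e⟩ ⟨f⟩ => ⟨e.trans f⟩ }

/-- The set of isomorphism types of the bounds of the class `C`. -/
def boundTypes (C : Set BundledGraph) : Set (Quotient isoSetoid) :=
  Quotient.mk isoSetoid '' {R | IsBound C R}

end ZeroOne

namespace ZeroOne

/-! Two non-consecutive vertices of `G_μ` are joined or not according to the letter at the larger
one alone. Hence, wherever a set of vertices has a gap, the part beyond the gap can be moved further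
right to any place carrying the same letters. Conversely, an embedding of a long interval in which
both letters keep occurring is essentially a translation (`Represents.translation`).

Non-periodic case. If factors overlapping in at least `N` letters could always be glued, arbitrarily
long periodic words would be factors, and uniform recurrence would impose their period on `μ`
(`Word.UniformlyRecurrent.periodic_of_glue`). So some pair cannot be glued. The would-be glued word,
preceded by a long stretch of `μ`, gives a graph that rigidity keeps out of the age, while any `N`
of its vertices leave a gap at which the two factors can be read apart
(`exists_locally_represented`). A minimal bad subgraph is a bound with more than `N` vertices.

Periodic case. Suppose a bound minus a vertex contained a long interval. This interval would anchor
every embedding of a proper part, and embeddings of the part below and the part above could be glued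
(`not_long_interval_of_periodic`). So a bound minus a vertex is a sequence of runs of bounded
length, and Higman's lemma embeds one term of any infinite sequence of bounds in a later one
(`exists_lt_embedding`); but bounds form an antichain. -/

/-! ### Graphs of two-sided words and their partial embeddings -/

/-- The graph on `ℤ` of the two-sided word whose letter at `z` is `1` if and only if `w z`. -/
def wordGraph (w : ℤ → Prop) : SimpleGraph ℤ where
  Adj i j := (i < j ∧ (w j ↔ j = i + 1)) ∨ (j < i ∧ (w i ↔ i = j + 1))
  symm := ⟨fun _ _ h => h.symm⟩
  loopless := ⟨fun i h => by simp at h⟩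

theorem wordGraph_adj_of_lt {w : ℤ → Prop} {i j : ℤ} (h : i < j) :
    (wordGraph w).Adj i j ↔ (w j ↔ j = i + 1) := by
  simp [wordGraph, h, h.le]

theorem wordGraph_adj_of_add_one_lt {w : ℤ → Prop} {i j : ℤ} (h : i + 1 < j) :
    (wordGraph w).Adj i j ↔ ¬ w j := by
  rw [wordGraph_adj_of_lt (by omega)]
  have : j ≠ i + 1 := by omega
  simp [this]

theorem wordGraph_adj_congr {w x : ℤ → Prop} {i j i' j' : ℤ} (h : j - i = j' - i')
    (hi : w i ↔ x i') (hj : w j ↔ x j') : (wordGraph w).Adj i j ↔ (wordGraph x).Adj i' j' := by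
  rcases lt_trichotomy i j with hij | rfl | hij
  · rw [wordGraph_adj_of_lt hij, wordGraph_adj_of_lt (by omega), hj]
    have : j = i + 1 ↔ j' = i' + 1 := by omega
    rw [this]
  · obtain rfl : i' = j' := by omega
    simp
  · rw [SimpleGraph.adj_comm, SimpleGraph.adj_comm _ i', wordGraph_adj_of_lt hij,
      wordGraph_adj_of_lt (by omega), hi]
    have : i = j + 1 ↔ i' = j' + 1 := by omega
    rw [this]

/-- `h` embeds the subgraph of `G` induced on `s` in the graph of the two-sided word `w`. -/
def Represents (w : ℤ → Prop) {V : Type} (G : SimpleGraph V) (s : Set V) (h : V → ℤ) : Prop :=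
  Set.InjOn h s ∧ ∀ u ∈ s, ∀ v ∈ s, ((wordGraph w).Adj (h u) (h v) ↔ G.Adj u v)

theorem Represents.sub_period {w : ℤ → Prop} {V : Type} {G : SimpleGraph V} {s : Set V}
    {h : V → ℤ} (H : Represents w G s h) {d : ℤ} (hd : Function.Periodic w d) :
    Represents w G s (fun v => h v - d) := by
  refine ⟨fun u hu v hv huv => H.1 hu hv (by simpa using huv), fun u hu v hv => ?_⟩
  rw [← H.2 u hu v hv]
  exact wordGraph_adj_congr (by ring) (by rw [hd.sub_eq]) (by rw [hd.sub_eq])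

/-! ### Rigidity: embeddings of long intervals are translations -/

section Rigidity

variable {w x : ℤ → Prop} {c d : ℤ} {h : ℤ → ℤ}

/-- Adjacency to a topmost vertex distinguishes only its immediate predecessor. Among `i - 1`, `c`,
`c + 1` the odd one out is `i - 1`, and its image must be the odd one out as well; with fewer than
three vertices to compare, the odd one could not be recognised. -/
theorem Represents.pred_of_forall_lt (H : Represents w (wordGraph x) (Set.Icc c d) h) {i : ℤ}
    (hci : c + 3 ≤ i) (hid : i ≤ d) (hlt : ∀ j, c ≤ j → j < i → h j < h i) :
    h (i - 1) = h i - 1 ∧ (w (h i) ↔ x i) := by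
  have key : ∀ j, c ≤ j → j < i → ((w (h i) ↔ h i = h j + 1) ↔ (x i ↔ i = j + 1)) := by
    intro j hj hji
    rw [← wordGraph_adj_of_lt (hlt j hj hji), ← wordGraph_adj_of_lt hji]
    exact H.2 j ⟨hj, by omega⟩ i ⟨by omega, hid⟩
  have h1 := key (i - 1) (by omega) (by omega)
  have h2 := key c (by omega) (by omega)
  have h3 := key (c + 1) (by omega) (by omega)
  have e1 : i = i - 1 + 1 := by omega
  have e2 : ¬ i = c + 1 := by omega
  have e3 : ¬ i = c + 1 + 1 := by omega
  have hne : h c ≠ h (c + 1) := fun e => by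
    have := H.1 ⟨le_refl _, by omega⟩ ⟨by omega, by omega⟩ e
    omega
  simp only [← e1, e2, e3, iff_true, iff_false] at h1 h2 h3
  by_cases a1 : h i = h (i - 1) + 1
  · refine ⟨by omega, ?_⟩
    simpa [a1] using h1
  · exfalso
    by_cases a2 : h i = h c + 1
    · have a3 : ¬ h i = h (c + 1) + 1 := by omega
      simp only [a1, a3, iff_false] at h1 h3
      tauto
    · simp only [a1, a2, iff_false] at h1 h2
      tauto

/-- Once `h (i - 1) = h i - 1`, injectivity puts all earlier images below `h (i - 1)`, so `i - 1` is
topmost in its turn and the argument descends. -/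
theorem Represents.translation_of_forall_lt (H : Represents w (wordGraph x) (Set.Icc c d) h)
    {i : ℤ} (hid : i ≤ d) (hlt : ∀ j, c ≤ j → j < i → h j < h i) (t : ℕ)
    (ht : c + 2 ≤ i - t) : h (i - t) = h i - t ∧ (∀ j, c ≤ j → j < i - t → h j < h (i - t)) ∧
      (c + 3 ≤ i - t → (w (h (i - t)) ↔ x (i - t))) := by
  induction t with
  | zero =>
    simp only [Nat.cast_zero, sub_zero, true_and]
    exact ⟨hlt, fun h3 => (H.pred_of_forall_lt h3 hid hlt).2⟩
  | succ t ih =>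
    push_cast at ht ⊢
    obtain ⟨h1, h2, -⟩ := ih (by omega)
    have h3 := (H.pred_of_forall_lt (i := i - t) (by omega) (by omega) h2).1
    have e : i - (t + 1 : ℤ) = i - t - 1 := by ring
    have h4 : ∀ j, c ≤ j → j < i - t - 1 → h j < h (i - t - 1) := by
      intro j hj hji
      have h5 := h2 j hj (by omega)
      have h6 : h j ≠ h (i - t - 1) := fun e => by
        have := H.1 ⟨hj, by omega⟩ ⟨by omega, by omega⟩ e
        omega
      omega
    rw [e]
    exact ⟨by omega, h4, fun h5 => (H.pred_of_forall_lt h5 (by omega) h4).2⟩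

/-- Every embedding of the graph of a long enough interval of a word, both letters occurring in all
windows of length `K` of this interval, is a translation outside the first two vertices. -/
theorem Represents.translation (H : Represents w (wordGraph x) (Set.Icc c d) h) {K : ℕ}
    (hK : ∀ i, c ≤ i → i + K ≤ d →
      (∃ k, i ≤ k ∧ k < i + K ∧ x k) ∧ ∃ k, i ≤ k ∧ k < i + K ∧ ¬ x k)
    (hcd : c + 3 * K + 10 ≤ d) :
    (∀ k, c + 2 ≤ k → k ≤ d → h k = h d - (d - k)) ∧
      ∀ k, c + 3 ≤ k → k ≤ d → (w (h k) ↔ x k) := by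
  obtain ⟨m, ⟨hcm, hmd⟩, hmax⟩ := Set.exists_max_image (Set.Icc c d) h (Set.finite_Icc c d)
    ⟨c, le_refl _, by omega⟩
  have hlt : ∀ j, c ≤ j → j ≤ d → j ≠ m → h j < h m := fun j hj hjd hjm =>
    lt_of_le_of_ne (hmax j ⟨hj, hjd⟩) fun e => hjm (H.1 ⟨hj, hjd⟩ ⟨hcm, hmd⟩ e)
  -- All images lie below `h m`, so the letters `x k` with `k ≥ m + 2` equal the single letter `w (h
  -- m)`, with at most one exception. Two disjoint windows supply each letter twice, which is one
  -- occurrence too many.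
  by_cases hsmall : m + 2 * K + 2 ≤ d
  · exfalso
    have key : ∀ k, m + 2 ≤ k → k ≤ d → h m ≠ h k + 1 → (w (h m) ↔ x k) := by
      intro k hk hkd hne
      have h1 := H.2 k ⟨by omega, hkd⟩ m ⟨hcm, hmd⟩
      rw [wordGraph_adj_of_lt (hlt k (by omega) hkd (by omega)), SimpleGraph.adj_comm,
        wordGraph_adj_of_add_one_lt (by omega)] at h1
      simp only [hne, iff_false] at h1
      tauto
    obtain ⟨⟨k1, a1, b1, c1⟩, l1, a1', b1', c1'⟩ := hK (m + 2) (by omega) (by omega)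
    obtain ⟨⟨k2, a2, b2, c2⟩, l2, a2', b2', c2'⟩ := hK (m + 2 + K) (by omega) (by omega)
    have inj : ∀ k l, m + 2 ≤ k → k < l → l ≤ d → h k ≠ h l := fun k l hk hkl hl e => by
      have := H.1 ⟨by omega, by omega⟩ ⟨by omega, hl⟩ e
      omega
    have hw : w (h m) := by
      by_cases e : h m = h k1 + 1
      · have := inj k1 k2 a1 (by omega) (by omega)
        exact (key k2 (by omega) (by omega) (by omega)).2 c2
      · exact (key k1 (by omega) (by omega) e).2 c1
    by_cases e : h m = h l1 + 1
    · have := inj l1 l2 a1' (by omega) (by omega)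
      exact c2' ((key l2 (by omega) (by omega) (by omega)).1 hw)
    · exact c1' ((key l1 (by omega) (by omega) e).1 hw)
  have hT := H.translation_of_forall_lt (i := m) hmd
    (fun j hj hjm => hlt j hj (by omega) (by omega))
  have hT' : ∀ k, c + 2 ≤ k → k ≤ m → h k = h m - (m - k) ∧ (c + 3 ≤ k → (w (h k) ↔ x k)) := by
    intro k hk hkm
    obtain ⟨t, ht⟩ := Int.eq_ofNat_of_zero_le (show 0 ≤ m - k by omega)
    obtain rfl : k = m - t := by omega
    obtain ⟨h1, -, h2⟩ := hT t hk
    exact ⟨by omega, h2⟩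
  obtain rfl | hne := eq_or_ne m d
  · exact ⟨fun k hk hkm => (hT' k hk hkm).1, fun k hk hkm => (hT' k (by omega) hkm).2 hk⟩
  exfalso
  -- The translated block leaves no room for `h d`, which therefore falls below it. Adjacency to `d`
  -- then reads `x k` on one side and `x d` on the other, so `x` would be constant on a whole
  -- window.
  have hd := hlt d (by omega) le_rfl hne.symm
  have hd2 : h d < h (c + 2) := by
    by_contra! hcon
    have h2 := (hT' (c + 2) le_rfl (by omega)).1
    have h3 := (hT' (m - (h m - h d)) (by omega) (by omega)).1
    have := H.1 ⟨by omega, by omega⟩ ⟨by omega, le_rfl⟩ (h3.trans (by ring : _ = h d))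
    omega
  have key : ∀ k, c + 3 ≤ k → k ≤ m → k + 1 < d → (x k ↔ x d) := by
    intro k hk hkm hkd
    have h1 := H.2 d ⟨by omega, le_rfl⟩ k ⟨by omega, by omega⟩
    obtain ⟨h2, h3⟩ := hT' k (by omega) hkm
    have h4 := (hT' (c + 2) le_rfl (by omega)).1
    rw [wordGraph_adj_of_add_one_lt (by omega), h3 hk, SimpleGraph.adj_comm,
      wordGraph_adj_of_add_one_lt hkd] at h1
    tauto
  obtain ⟨⟨k, a, b, hk⟩, l, a', b', hl⟩ := hK (c + 3) (by omega) (by omega)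
  exact hl ((key l a' (by omega) (by omega)).2 ((key k a (by omega) (by omega)).1 hk))

end Rigidity

/-! ### Periodic words: a bound minus a vertex has no long interval -/

theorem exists_mem_window_of_periodic {w : ℤ → Prop} {p : ℕ} (hp : 0 < p)
    (hw : Function.Periodic w p) {q : ℤ → Prop} (hq : ∀ i j, w i = w j → q i → q j)
    (h : ∃ i, q i) (i : ℤ) : ∃ k, i ≤ k ∧ k < i + p ∧ q k := by
  obtain ⟨j, hj⟩ := h
  have hp' : (0 : ℤ) < p := by exact_mod_cast hp
  have h1 := Int.emod_nonneg (j - i) hp'.ne'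
  have h2 := Int.emod_lt_of_pos (j - i) hp'
  refine ⟨i + (j - i) % p, by omega, by omega, hq j _ ?_ hj⟩
  have h3 : i + (j - i) % p = j - ((j - i) / p) * p := by
    have := Int.emod_add_mul_ediv (j - i) p
    linarith
  rw [h3]
  exact ((hw.int_mul _).sub_eq _).symm

theorem periodic_of_window {w : ℤ → Prop} {p : ℕ} (hp : 0 < p) (hw : Function.Periodic w p)
    {d i : ℤ} (h : ∀ z, i ≤ z → z < i + p → (w (z + d) ↔ w z)) : Function.Periodic w d := by
  intro z
  have hp' : (0 : ℤ) < p := by exact_mod_cast hp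
  have h1 := Int.emod_nonneg (z - i) hp'.ne'
  have h2 := Int.emod_lt_of_pos (z - i) hp'
  have h3 : i + (z - i) % p = z - ((z - i) / p) * p := by
    have := Int.emod_add_mul_ediv (z - i) p
    linarith
  have h4 := h (i + (z - i) % p) (by omega) (by omega)
  have hq : Function.Periodic w ((z - i) / p * p) := hw.int_mul _
  rw [h3, sub_add_eq_add_sub, hq.sub_eq, hq.sub_eq] at h4
  exact propext h4

/-- If all proper induced subgraphs of `R`, but not `R`, embed in the graph of a periodic word with
two letters, then the image of no such embedding that misses at most one vertex contains a long
interval. -/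
theorem not_long_interval_of_periodic {w : ℤ → Prop} {p : ℕ} (hp : 0 < p)
    (hw : Function.Periodic w p) (h1 : ∃ i, w i) (h0 : ∃ i, ¬ w i) {V : Type}
    {R : SimpleGraph V} (hR : ¬ ∃ h, Represents w R Set.univ h)
    (hall : ∀ s : Set V, s ≠ Set.univ → ∃ h, Represents w R s h)
    {v₀ : V} {h₀ : V → ℤ} (H₀ : Represents w R {v₀}ᶜ h₀) (c : ℤ) :
    ¬ Set.Icc (c - 1) (c + (3 * p + 11)) ⊆ h₀ '' {v₀}ᶜ := by
  intro hsub
  have win1 := exists_mem_window_of_periodic hp hw (q := w) (fun i j e hi => e ▸ hi) h1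
  have win0 := exists_mem_window_of_periodic hp hw (q := fun i => ¬ w i)
    (fun i j e hi => e ▸ hi) h0
  obtain ⟨d, hd⟩ : ∃ d : ℤ, d = c + 3 * p + 10 := ⟨_, rfl⟩
  have hsub' : ∀ z, c - 1 ≤ z → z ≤ d + 1 → ∃ v, v ≠ v₀ ∧ h₀ v = z := fun z h1 h2 => by
    obtain ⟨v, hv, e⟩ := hsub (⟨h1, by omega⟩ : z ∈ Set.Icc (c - 1) (c + (3 * p + 11)))
    exact ⟨v, hv, e⟩
  have : Nonempty V := ⟨v₀⟩
  choose! α hα0 hα using hsub'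
  have αinj : ∀ y z, c - 1 ≤ y → y ≤ d + 1 → c - 1 ≤ z → z ≤ d + 1 → α y = α z → y = z := by
    intro y z hy hy' hz hz' e
    rw [← hα y hy hy', e, hα z hz hz']
  -- By rigidity the embedding translates the block, and the letters agree on a full period, so the
  -- translation length is a period of `w`. Subtracting it makes all these embeddings agree on the
  -- block.
  have anchor : ∀ s : Set V, s ≠ Set.univ → α '' Set.Icc c d ⊆ s →
      ∃ h, Represents w R s h ∧ ∀ z, c + 2 ≤ z → z ≤ d → h (α z) = z := by
    intro s hs hAs
    obtain ⟨h, H⟩ := hall s hs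
    have H' : Represents w (wordGraph w) (Set.Icc c d) (fun z => h (α z)) := by
      refine ⟨fun y hy z hz e => ?_, fun y hy z hz => ?_⟩
      · exact αinj y z (by linarith [hy.1]) (by linarith [hy.2]) (by linarith [hz.1])
          (by linarith [hz.2]) (H.1 (hAs ⟨y, hy, rfl⟩) (hAs ⟨z, hz, rfl⟩) e)
      · have e1 := hα y (by linarith [hy.1]) (by linarith [hy.2])
        have e2 := hα z (by linarith [hz.1]) (by linarith [hz.2])
        rw [H.2 _ (hAs ⟨y, hy, rfl⟩) _ (hAs ⟨z, hz, rfl⟩),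
          ← H₀.2 _ (hα0 y (by linarith [hy.1]) (by linarith [hy.2])) _
            (hα0 z (by linarith [hz.1]) (by linarith [hz.2])), e1, e2]
    obtain ⟨t1, t2⟩ := H'.translation (K := p) (fun i _ _ => ⟨win1 i, win0 i⟩) (by omega)
    have hper : Function.Periodic w (h (α d) - d) := by
      refine periodic_of_window hp hw (i := c + 3) fun z hz hz' => ?_
      have e := t1 z (by omega) (by omega)
      rw [← t2 z hz (by omega), e]
      ring_nf
    refine ⟨_, H.sub_period hper, fun z hz hz' => ?_⟩
    have e := t1 z hz hz'
    linarith
  have αA : ∀ z, c ≤ z → z ≤ d → α z ∈ α '' Set.Icc c d := fun z h1 h2 => ⟨z, ⟨h1, h2⟩, rfl⟩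
  have side : ∀ (s : Set V) (h : V → ℤ), Represents w R s h → α '' Set.Icc c d ⊆ s →
      (∀ z, c + 2 ≤ z → z ≤ d → h (α z) = z) → ∀ v ∈ s, (∀ z, c + 2 ≤ z → z ≤ d → v ≠ α z) →
      h v < c + 2 ∨ d < h v := by
    intro s h H hA hid v hv hne
    by_contra! hcon
    exact hne (h v) hcon.1 hcon.2
      (H.1 hv (hA (αA _ (by omega) hcon.2)) (hid _ hcon.1 hcon.2).symm)
  have above : ∀ (s : Set V) (h : V → ℤ), Represents w R s h → α '' Set.Icc c d ⊆ s →
      (∀ z, c + 2 ≤ z → z ≤ d → h (α z) = z) → ∀ v ∈ s, d < h v →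
      ∀ z, c + 2 ≤ z → z < d → (R.Adj v (α z) ↔ ¬ w (h v)) := by
    intro s h H hA hid v hv hlt z hz hz'
    rw [SimpleGraph.adj_comm, ← H.2 _ (hA (αA z (by omega) (by omega))) _ hv,
      hid z hz (by omega), wordGraph_adj_of_add_one_lt (by omega)]
  have below : ∀ (s : Set V) (h : V → ℤ), Represents w R s h → α '' Set.Icc c d ⊆ s →
      (∀ z, c + 2 ≤ z → z ≤ d → h (α z) = z) → ∀ v ∈ s, h v < c + 2 →
      ∀ z, c + 3 ≤ z → z < d → (R.Adj v (α z) ↔ ¬ w z) := by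
    intro s h H hA hid v hv hlt z hz hz'
    rw [← H.2 _ hv _ (hA (αA z (by omega) (by omega))),
      hid z (by omega) (by omega), wordGraph_adj_of_add_one_lt (by omega)]
  -- `U` recovers from `R` alone the side of the block on which a vertex must land. From above, the
  -- vertex's own letter decides all its adjacencies to the block; from below, the letters of the
  -- block do, and these vary. The vertex `α d` is left out because it may be the immediate
  -- predecessor.
  obtain ⟨U, hU⟩ : ∃ U : V → Prop,
      ∀ v, U v ↔ ∀ z, c + 2 ≤ z → z < d → (R.Adj v (α z) ↔ R.Adj v (α (c + 2))) :=
    ⟨_, fun _ => Iff.rfl⟩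
  have hU1 : ∀ (s : Set V) (h : V → ℤ), Represents w R s h → α '' Set.Icc c d ⊆ s →
      (∀ z, c + 2 ≤ z → z ≤ d → h (α z) = z) → ∀ v ∈ s, d < h v → U v := by
    intro s h H hA hid v hv hlt
    rw [hU]
    intro z hz hz'
    rw [above s h H hA hid v hv hlt z hz hz',
      above s h H hA hid v hv hlt (c + 2) le_rfl (by omega)]
  have hU0 : ∀ (s : Set V) (h : V → ℤ), Represents w R s h → α '' Set.Icc c d ⊆ s →
      (∀ z, c + 2 ≤ z → z ≤ d → h (α z) = z) → ∀ v ∈ s, h v < c + 2 → ¬ U v := by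
    intro s h H hA hid v hv hlt
    rw [hU]
    intro hcon
    obtain ⟨k, a, b, hk⟩ := win1 (c + 3)
    obtain ⟨l, a', b', hl⟩ := win0 (c + 3)
    have e1 := hcon k (by omega) (by omega)
    have e2 := hcon l (by omega) (by omega)
    rw [below s h H hA hid v hv hlt k a (by omega)] at e1
    rw [below s h H hA hid v hv hlt l a' (by omega)] at e2
    tauto
  have hA₀ : α '' Set.Icc c d ⊆ {v₀}ᶜ := by
    rintro _ ⟨z, hz, rfl⟩
    exact hα0 z (by linarith [hz.1]) (by linarith [hz.2])
  have hid₀ : ∀ z, c + 2 ≤ z → z ≤ d → h₀ (α z) = z := fun z h1 h2 =>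
    hα z (by omega) (by omega)
  have htop : U (α (d + 1)) := hU1 _ _ H₀ hA₀ hid₀ _ (hα0 _ (by omega) le_rfl)
    (by rw [hα _ (by omega) le_rfl]; omega)
  have hbot : ∀ z, c - 1 ≤ z → z < c + 2 → ¬ U (α z) := fun z h1 h2 =>
    hU0 _ _ H₀ hA₀ hid₀ _ (hα0 _ h1 (by omega)) (by rw [hα _ h1 (by omega)]; exact h2)
  have hne0 : ∀ y, c - 1 ≤ y → y ≤ d + 1 → (∀ z, c ≤ z → z ≤ d → y ≠ z) →
      α y ∉ α '' Set.Icc c d := by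
    rintro y h1 h2 h3 ⟨z, hz, e⟩
    exact h3 z hz.1 hz.2 (αinj z y (by linarith [hz.1]) (by linarith [hz.2]) h1 h2 e).symm
  have hAtop := hne0 (d + 1) (by omega) le_rfl (fun z _ _ => by omega)
  have hAbot := hne0 (c - 1) le_rfl (by omega) (fun z _ _ => by omega)
  obtain ⟨f, Hf, hf⟩ := anchor (α '' Set.Icc c d ∪ {v | ¬ U v})
    (fun e => by
      have : α (d + 1) ∈ α '' Set.Icc c d ∪ {v | ¬ U v} := e ▸ Set.mem_univ _
      rcases this with h | h
      · exact hAtop h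
      · exact h htop) Set.subset_union_left
  obtain ⟨g, Hg, hg⟩ := anchor (α '' Set.Icc c d ∪ {v | U v})
    (fun e => by
      have : α (c - 1) ∈ α '' Set.Icc c d ∪ {v | U v} := e ▸ Set.mem_univ _
      rcases this with h | h
      · exact hAbot h
      · exact hbot _ le_rfl (by omega) h) Set.subset_union_left
  obtain ⟨B, hB⟩ : ∃ B : Set V, B = α '' Set.Icc (c + 2) d := ⟨_, rfl⟩
  have hBA : B ⊆ α '' Set.Icc c d := by
    rw [hB]
    exact Set.image_mono (Set.Icc_subset_Icc_left (by omega))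
  have hnB : ∀ v, v ∉ B → ∀ z, c + 2 ≤ z → z ≤ d → v ≠ α z := by
    rintro v hv z h1 h2 rfl
    exact hv (hB ▸ ⟨z, ⟨h1, h2⟩, rfl⟩)
  have hfB : ∀ v ∈ B, f v = g v ∧ c + 2 ≤ f v ∧ f v ≤ d := by
    rw [hB]
    rintro _ ⟨z, ⟨h1, h2⟩, rfl⟩
    rw [hf z h1 h2, hg z h1 h2]
    exact ⟨rfl, h1, h2⟩
  have hfY : ∀ v, v ∉ B → ¬ U v → f v < c + 2 := fun v hv hu =>
    (side _ f Hf Set.subset_union_left hf v (Or.inr hu) (hnB v hv)).resolve_right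
      fun h => hu (hU1 _ f Hf Set.subset_union_left hf v (Or.inr hu) h)
  have hgX : ∀ v, v ∉ B → U v → d < g v := fun v hv hu =>
    (side _ g Hg Set.subset_union_left hg v (Or.inr hu) (hnB v hv)).resolve_left
      fun h => hU0 _ g Hg Set.subset_union_left hg v (Or.inr hu) h hu
  -- Neither `f` nor `g` sees such a pair, so it is tested on the block together with `u` and `v`.
  -- This set is proper: it cannot contain all three of `v₀`, `α (d + 1)` and `α (c - 1)`, which are
  -- distinct and outside the block.
  have cross : ∀ u v, u ∉ B → ¬ U u → v ∉ B → U v → (R.Adj u v ↔ ¬ w (g v)) := by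
    intro u v huB hu hvB hv
    have hs : insert u (insert v (α '' Set.Icc c d)) ≠ Set.univ := by
      intro e
      have m1 : v₀ ∈ insert u (insert v (α '' Set.Icc c d)) := e ▸ Set.mem_univ _
      have m2 : α (d + 1) ∈ insert u (insert v (α '' Set.Icc c d)) := e ▸ Set.mem_univ _
      have m3 : α (c - 1) ∈ insert u (insert v (α '' Set.Icc c d)) := e ▸ Set.mem_univ _
      have n1 : v₀ ∉ α '' Set.Icc c d := fun h => hA₀ h rfl
      have n2 := hα0 (d + 1) (by omega) le_rfl
      have n3 := hα0 (c - 1) le_rfl (by omega)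
      have n4 := hbot (c - 1) le_rfl (by omega)
      simp only [Set.mem_insert_iff, n1, hAtop, hAbot, or_false] at m1 m2 m3
      have n5 : α (d + 1) ≠ u := by rintro rfl; exact hu htop
      have n6 : α (c - 1) ≠ v := by rintro rfl; exact n4 hv
      have e2 := m2.resolve_left n5
      have e3 := m3.resolve_right n6
      rcases m1 with h | h
      · exact n3 (e3.trans h.symm)
      · exact n2 (e2.trans h.symm)
    have hsub1 : α '' Set.Icc c d ⊆ insert u (insert v (α '' Set.Icc c d)) :=
      (Set.subset_insert _ _).trans (Set.subset_insert _ _)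
    obtain ⟨k, Hk, hk⟩ := anchor _ hs hsub1
    have mu : u ∈ insert u (insert v (α '' Set.Icc c d)) := Set.mem_insert _ _
    have mv : v ∈ insert u (insert v (α '' Set.Icc c d)) :=
      Set.mem_insert_of_mem _ (Set.mem_insert _ _)
    have hku := (side _ k Hk hsub1 hk u mu (hnB u huB)).resolve_right
      fun h => hu (hU1 _ k Hk hsub1 hk u mu h)
    have hkv := (side _ k Hk hsub1 hk v mv (hnB v hvB)).resolve_left
      fun h => hU0 _ k Hk hsub1 hk v mv h hv
    rw [← Hk.2 u mu v mv, wordGraph_adj_of_add_one_lt (by omega),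
      ← above _ k Hk hsub1 hk v mv hkv (c + 2) le_rfl (by omega),
      ← above _ g Hg Set.subset_union_left hg v (Or.inr hv) (hgX v hvB hv) (c + 2) le_rfl
        (by omega)]
  classical
  have hX : ∀ v, ¬ (v ∈ B ∨ ¬ U v) → v ∉ B ∧ U v := fun v hv => by tauto
  have hYf : ∀ v, v ∈ B ∨ ¬ U v → v ∈ α '' Set.Icc c d ∪ {v | ¬ U v} := fun v hv =>
    hv.imp (fun h => hBA h) id
  have hYd : ∀ v, v ∈ B ∨ ¬ U v → f v ≤ d := fun v hv => by
    by_cases hvB : v ∈ B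
    · exact (hfB v hvB).2.2
    · have := hfY v hvB (hv.resolve_left hvB)
      omega
  have mixed : ∀ u v, (u ∈ B ∨ ¬ U u) → v ∉ B → U v →
      ((wordGraph w).Adj (f u) (g v) ↔ R.Adj u v) := by
    intro u v hu hvB hv
    by_cases huB : u ∈ B
    · rw [(hfB u huB).1]
      exact Hg.2 u (Or.inl (hBA huB)) v (Or.inr hv)
    · have hu' := hu.resolve_left huB
      have h1 := hfY u huB hu'
      have h2 := hgX v hvB hv
      rw [cross u v huB hu' hvB hv, wordGraph_adj_of_add_one_lt (by omega)]
  refine hR ⟨fun v => if v ∈ B ∨ ¬ U v then f v else g v, fun u _ v _ e => ?_,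
    fun u _ v _ => ?_⟩
  · simp only [] at e
    split_ifs at e with hu hv hv
    · exact Hf.1 (hYf u hu) (hYf v hv) e
    · have h1 := hYd u hu
      have h2 := hgX v (hX v hv).1 (hX v hv).2
      omega
    · have h1 := hYd v hv
      have h2 := hgX u (hX u hu).1 (hX u hu).2
      omega
    · exact Hg.1 (Or.inr (hX u hu).2) (Or.inr (hX v hv).2) e
  · simp only []
    split_ifs with hu hv hv
    · exact Hf.2 u (hYf u hu) v (hYf v hv)
    · exact mixed u v hu (hX v hv).1 (hX v hv).2
    · rw [SimpleGraph.adj_comm, R.adj_comm]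
      exact mixed v u hv (hX u hu).1 (hX u hu).2
    · exact Hg.2 u (Or.inr (hX u hu).2) v (Or.inr (hX v hv).2)

/-! ### Higman's lemma for sequences of bounded runs -/

theorem exists_strictMonoOn_of_map_sublist {A : Type*} {B B' : Finset ℤ} {f f' : ℤ → A}
    (h : (B.sort.map f).Sublist (B'.sort.map f')) :
    ∃ g : ℤ → ℤ, StrictMonoOn g B ∧ ∀ k ∈ B, g k ∈ B' ∧ f' (g k) = f k := by
  obtain ⟨l, hl, e⟩ := List.sublist_map_iff.1 h
  have hlen : B.sort.length = l.length := by simpa using congrArg List.length e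
  have hs : B.sort.Pairwise (· < ·) := B.sortedLT_sort.pairwise
  have hs' : l.Pairwise (· < ·) := B'.sortedLT_sort.pairwise.sublist hl
  have hidx : ∀ k ∈ B, ∃ i, ∃ hi : i < B.sort.length, B.sort[i] = k := fun k hk =>
    List.mem_iff_getElem.1 ((Finset.mem_sort _).2 hk)
  choose! i hi hik using hidx
  refine ⟨fun k => l.getD (i k) 0, fun k hk k' hk' hkk => ?_, fun k hk => ?_⟩
  · have h1 := hi k hk
    have h2 := hi k' hk'
    have h3 : i k < i k' := by
      by_contra! hcon
      rcases hcon.lt_or_eq with h4 | h4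
      · have := List.pairwise_iff_getElem.1 hs _ _ h2 h1 h4
        rw [hik k hk, hik k' hk'] at this
        omega
      · have e1 := hik k hk
        have e2 := hik k' hk'
        simp only [h4] at e2
        omega
    simp only []
    rw [List.getD_eq_getElem _ _ (hlen ▸ h1), List.getD_eq_getElem _ _ (hlen ▸ h2)]
    exact List.pairwise_iff_getElem.1 hs' _ _ _ _ h3
  · have h1 := hi k hk
    simp only []
    rw [List.getD_eq_getElem _ _ (hlen ▸ h1)]
    refine ⟨(Finset.mem_sort _).1 (hl.subset (List.getElem_mem _)), ?_⟩
    have e1 : (B.sort.map f)[i k]? = (l.map f')[i k]? := by rw [e]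
    rw [List.getElem?_map, List.getElem?_map, List.getElem?_eq_getElem h1,
      List.getElem?_eq_getElem (hlen ▸ h1), hik k hk] at e1
    simpa using e1.symm

/-- This is Higman's lemma with equality as the order on the finite alphabet, so that the comparison
of lists is a literal sublist relation. -/
theorem exists_lt_map_sublist {A : Type*} [Finite A] (B : ℕ → Finset ℤ) (f : ℕ → ℤ → A) :
    ∃ i j, i < j ∧ ((B i).sort.map (f i)).Sublist ((B j).sort.map (f j)) := by
  have h1 := (Set.toFinite (Set.univ : Set A)).partiallyWellOrderedOn (r := Eq)
  have h2 := Set.PartiallyWellOrderedOn.partiallyWellOrderedOn_sublistForall₂ _ h1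
  obtain ⟨i, j, hij, h⟩ := h2 fun n =>
    ⟨((B n).sort (fun a b => a ≤ b)).map (f n), fun _ _ => Set.mem_univ _⟩
  refine ⟨i, j, hij, ?_⟩
  obtain ⟨l, hl, hs⟩ := List.sublistForall₂_iff.1 h
  rw [List.forall₂_eq_eq_eq] at hl
  subst hl
  exact hs

/-- The element `z` lies in the run of consecutive elements of `S` that starts at `k`. -/
def InRun (S : Set ℤ) (k z : ℤ) : Prop :=
  k - 1 ∉ S ∧ k ≤ z ∧ ∀ y, k ≤ y → y ≤ z → y ∈ S

theorem exists_inRun {S : Set ℤ} {l : ℕ} (hS : ∀ c : ℤ, ¬ Set.Ico c (c + l) ⊆ S) {z : ℤ}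
    (hz : z ∈ S) : ∃ k, InRun S k z ∧ z < k + l := by
  classical
  have hex : ∃ t : ℕ, z - t ∉ S := by
    by_contra! hcon
    refine hS (z - l + 1) fun y hy => ?_
    obtain ⟨t, ht⟩ := Int.eq_ofNat_of_zero_le (show 0 ≤ z - y by linarith [hy.2])
    obtain rfl : y = z - t := by omega
    exact hcon t
  have hrun : ∀ y, z - Nat.find hex + 1 ≤ y → y ≤ z → y ∈ S := by
    intro y hy hyz
    obtain ⟨t, ht⟩ := Int.eq_ofNat_of_zero_le (show 0 ≤ z - y by omega)
    obtain rfl : y = z - t := by omega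
    exact not_not.1 (Nat.find_min hex (by omega))
  have hpos : Nat.find hex ≠ 0 := fun e => by
    have := Nat.find_spec hex
    rw [e] at this
    simp [hz] at this
  refine ⟨z - Nat.find hex + 1, ⟨?_, by omega, hrun⟩, ?_⟩
  · have := Nat.find_spec hex
    rwa [add_sub_cancel_right]
  · by_contra! hcon
    exact hS (z - Nat.find hex + 1) fun y hy => hrun y hy.1 (by linarith [hy.2])

theorem InRun.add_one_lt {S : Set ℤ} {k z k' z' : ℤ} (h : InRun S k z) (h' : InRun S k' z')
    (hk : k < k') : z + 1 < z' := by
  by_contra! hcon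
  by_cases hz : z < k' - 1
  · have := h'.2.1
    omega
  · exact h'.1 (h.2.2 _ (by omega) (by omega))

/-- A sequence of graphs, each of which becomes, after deletion of a vertex, a subgraph of the graph
of `w` without long intervals, has an embedding of some term in a later one. -/
theorem exists_lt_embedding (w : ℤ → Prop) (l : ℕ) (V : ℕ → Type) (G : ∀ n, SimpleGraph (V n))
    [∀ n, Finite (V n)] (v : ∀ n, V n) (h : ∀ n, V n → ℤ)
    (H : ∀ n, Represents w (G n) {v n}ᶜ (h n))
    (hl : ∀ n (c : ℤ), ¬ Set.Ico c (c + l) ⊆ h n '' {v n}ᶜ) :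
    ∃ i j, i < j ∧ Nonempty (G i ↪g G j) := by
  classical
  have hfin : ∀ n, {k | k ∈ h n '' {v n}ᶜ ∧ k - 1 ∉ h n '' {v n}ᶜ}.Finite := fun n =>
    (Set.toFinite (h n '' {v n}ᶜ)).subset fun k hk => hk.1
  -- The label of a run records its extent, its letters and its adjacencies to the deleted vertex.
  -- Runs are shorter than `l`, so the alphabet is finite.
  let content : ℕ → ℤ → (Fin l → Prop × Prop × Prop) := fun n k o =>
    (InRun (h n '' {v n}ᶜ) k (k + o), w (k + o),
      ∃ u, u ≠ v n ∧ h n u = k + o ∧ (G n).Adj (v n) u)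
  obtain ⟨i, j, hij, hsub⟩ := exists_lt_map_sublist (fun n => (hfin n).toFinset) content
  refine ⟨i, j, hij, ?_⟩
  obtain ⟨g, hg, hgB⟩ := exists_strictMonoOn_of_map_sublist hsub
  have run : ∀ u, u ≠ v i → ∃ k, InRun (h i '' {v i}ᶜ) k (h i u) ∧ h i u < k + l := fun u hu =>
    exists_inRun (hl i) ⟨u, hu, rfl⟩
  choose! κ hκ hκl using run
  have hκB : ∀ u, u ≠ v i → κ u ∈ (hfin i).toFinset := fun u hu => by
    rw [Set.Finite.mem_toFinset]
    exact ⟨(hκ u hu).2.2 _ le_rfl (hκ u hu).2.1, (hκ u hu).1⟩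
  have transfer : ∀ u, u ≠ v i → ∃ u', u' ≠ v j ∧ h j u' = g (κ u) + (h i u - κ u) ∧
      InRun (h j '' {v j}ᶜ) (g (κ u)) (h j u') ∧ (w (h i u) ↔ w (h j u')) ∧
      ((G i).Adj (v i) u ↔ (G j).Adj (v j) u') := by
    intro u hu
    obtain ⟨o, ho⟩ := Int.eq_ofNat_of_zero_le (show 0 ≤ h i u - κ u by linarith [(hκ u hu).2.1])
    have ho' : o < l := by
      have := hκl u hu
      omega
    have e := congrFun (hgB _ (hκB u hu)).2 ⟨o, ho'⟩
    have ei : κ u + (o : ℤ) = h i u := by omega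
    simp only [content, Prod.mk.injEq, ei] at e
    obtain ⟨e1, e2, e3⟩ := e
    have r1 : InRun (h j '' {v j}ᶜ) (g (κ u)) (g (κ u) + o) := e1.symm ▸ hκ u hu
    obtain ⟨u', hu', hu''⟩ := r1.2.2 _ r1.2.1 le_rfl
    refine ⟨u', hu', by omega, hu'' ▸ r1, by rw [← e2, hu''], ?_⟩
    constructor
    · intro ha
      obtain ⟨y, hy, hy', hy''⟩ := e3.symm ▸ (⟨u, hu, rfl, ha⟩ :
        ∃ y, y ≠ v i ∧ h i y = h i u ∧ (G i).Adj (v i) y)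
      rwa [← (H j).1 hy hu' (hy'.trans hu''.symm)]
    · intro ha
      obtain ⟨y, hy, hy', hy''⟩ := e3 ▸ (⟨u', hu', hu'', ha⟩ :
        ∃ y, y ≠ v j ∧ h j y = g (κ u) + o ∧ (G j).Adj (v j) y)
      rwa [← (H i).1 hy hu hy']
  have : Nonempty (V j) := ⟨v j⟩
  choose! F hF hFh hFr hFw hFa using transfer
  -- Distinct runs are separated by a gap on both sides of the map, so only the letter at the upper
  -- vertex counts, and the label preserves it.
  have lt_case : ∀ a b, a ≠ v i → b ≠ v i → κ a < κ b →
      h j (F a) + 1 < h j (F b) ∧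
        ((wordGraph w).Adj (h j (F a)) (h j (F b)) ↔ (wordGraph w).Adj (h i a) (h i b)) := by
    intro a b ha hb hab
    have h1 := (hκ a ha).add_one_lt (hκ b hb) hab
    have h2 := (hFr a ha).add_one_lt (hFr b hb) (hg (hκB a ha) (hκB b hb) hab)
    refine ⟨h2, ?_⟩
    rw [wordGraph_adj_of_add_one_lt h1, wordGraph_adj_of_add_one_lt h2, hFw b hb]
  have hadj : ∀ a b, a ≠ v i → b ≠ v i → ((G j).Adj (F a) (F b) ↔ (G i).Adj a b) := by
    intro a b ha hb
    rw [← (H j).2 _ (hF a ha) _ (hF b hb), ← (H i).2 a ha b hb]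
    rcases lt_trichotomy (κ a) (κ b) with hab | hab | hab
    · exact (lt_case a b ha hb hab).2
    · refine wordGraph_adj_congr ?_ (hFw a ha).symm (hFw b hb).symm
      rw [hFh a ha, hFh b hb, hab]
      ring
    · rw [SimpleGraph.adj_comm, (lt_case b a hb ha hab).2, SimpleGraph.adj_comm]
  have hinj : ∀ a b, a ≠ v i → b ≠ v i → F a = F b → a = b := by
    intro a b ha hb e
    have e' := congrArg (h j) e
    rcases lt_trichotomy (κ a) (κ b) with hab | hab | hab
    · have := (lt_case a b ha hb hab).1
      omega
    · rw [hFh a ha, hFh b hb, hab] at e'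
      exact (H i).1 ha hb (by omega)
    · have := (lt_case b a hb ha hab).1
      omega
  have inj : Function.Injective fun u => if u = v i then v j else F u := by
    intro a b e
    simp only [] at e
    split_ifs at e with ha hb hb
    · rw [ha, hb]
    · exact absurd e.symm (hF b hb)
    · exact absurd e (hF a ha)
    · exact hinj a b ha hb e
  refine ⟨⟨⟨_, inj⟩, fun {a b} => ?_⟩⟩
  change (G j).Adj (if a = v i then v j else F a) (if b = v i then v j else F b) ↔ _
  split_ifs with ha hb hb
  · simp [ha, hb]
  · rw [ha, hFa b hb]
  · rw [hb, (G j).adj_comm, (G i).adj_comm, hFa a ha]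
  · exact hadj a b ha hb

/-! ### From words on their domains to two-sided words -/

theorem WordDomain.positions_subset_vertices (D : WordDomain) : D.positions ⊆ D.vertices := by
  cases D <;> intro z <;> simp [WordDomain.positions, WordDomain.vertices] <;> omega

theorem WordDomain.ordConnected_positions (D : WordDomain) : D.positions.OrdConnected := by
  cases D <;> simp only [WordDomain.positions] <;> infer_instance

/-- The letter of `μ` at `z` is `1`. -/
def Word.IsOne (μ : Word) (z : ℤ) : Prop := ∃ hz : z ∈ μ.dom.positions, μ.letter ⟨z, hz⟩ = 1

theorem Word.isOne_iff {μ : Word} {z : ℤ} (hz : z ∈ μ.dom.positions) :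
    μ.IsOne z ↔ μ.letter ⟨z, hz⟩ = 1 :=
  ⟨fun h => h.2, fun h => ⟨hz, h⟩⟩

theorem Word.letter_eq_iff {μ : Word} {z : ℤ} (hz : z ∈ μ.dom.positions) (a : Fin 2) :
    μ.letter ⟨z, hz⟩ = a ↔ (μ.IsOne z ↔ a = 1) := by
  rw [μ.isOne_iff hz]
  generalize μ.letter ⟨z, hz⟩ = b
  revert a b
  decide

/-- `IsOne` is false outside the domain, which is harmless: a vertex without a letter, such as `-1`,
is never the larger end of a pair. -/
theorem Word.graph_adj_iff {μ : Word} (i j : μ.dom.vertices) :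
    μ.graph.Adj i j ↔ (wordGraph μ.IsOne).Adj i j := by
  have key : ∀ i j : μ.dom.vertices, (i : ℤ) < j →
      (μ.EdgeLT i j ∨ μ.EdgeLT j i ↔ (wordGraph μ.IsOne).Adj i j) := by
    intro i j hij
    have hj := WordDomain.mem_positions_of_lt i.2 j.2 hij
    have h0 : μ.letter ⟨j, hj⟩ = 0 ↔ ¬ μ.IsOne j := by simp [μ.letter_eq_iff hj]
    rw [wordGraph_adj_of_lt hij]
    simp only [Word.EdgeLT, hij, hij.not_gt, hj, true_and, false_and, or_false, exists_true_left,
      h0, ← μ.isOne_iff hj]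
    tauto
  change μ.EdgeLT i j ∨ μ.EdgeLT j i ↔ _
  rcases lt_trichotomy (i : ℤ) j with hij | hij | hij
  · exact key i j hij
  · rw [hij]
    simp [Word.EdgeLT]
  · rw [or_comm, key j i hij, SimpleGraph.adj_comm]

theorem induce_mem_age_iff {μ : Word} {V : Type} {G : SimpleGraph V} {s : Set V} :
    (⟨s, G.induce s⟩ : BundledGraph) ∈ age μ.graph ↔
      s.Finite ∧ ∃ h, Represents μ.IsOne G s h ∧ Set.MapsTo h s μ.dom.vertices := by
  classical
  constructor
  · rintro ⟨hfin, ⟨e⟩⟩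
    refine ⟨Set.toFinite s, fun v => if hv : v ∈ s then (e ⟨v, hv⟩ : ℤ) else 0,
      ⟨fun u hu v hv huv => ?_, fun u hu v hv => ?_⟩, fun v hv => ?_⟩
    · simp only [hu, hv, dif_pos] at huv
      exact congrArg Subtype.val (e.injective (Subtype.ext huv))
    · simp only [hu, hv, dif_pos]
      rw [← Word.graph_adj_iff, e.map_adj_iff]
      rfl
    · simp only [hv, dif_pos]
      exact (e ⟨v, hv⟩).2
  · rintro ⟨hfin, h, H, hm⟩
    have inj : Function.Injective fun v : s => (⟨h v, hm v.2⟩ : μ.dom.vertices) := fun u v e =>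
      Subtype.ext (H.1 u.2 v.2 (congrArg Subtype.val e))
    refine ⟨hfin, ⟨⟨⟨_, inj⟩, fun {u v} => ?_⟩⟩⟩
    change μ.graph.Adj ⟨h u, hm u.2⟩ ⟨h v, hm v.2⟩ ↔ _
    rw [Word.graph_adj_iff]
    exact H.2 u u.2 v v.2

theorem mem_age_of_embedding {V W U : Type} {K : SimpleGraph U} {G : SimpleGraph V}
    {H : SimpleGraph W} (e : G ↪g H) (h : (⟨W, H⟩ : BundledGraph) ∈ age K) :
    (⟨V, G⟩ : BundledGraph) ∈ age K := by
  obtain ⟨h1, ⟨f⟩⟩ := h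
  have : Finite W := h1
  exact ⟨Finite.of_injective e e.injective, ⟨f.comp e⟩⟩

theorem mem_age_iff {μ : Word} {V : Type} {G : SimpleGraph V} :
    (⟨V, G⟩ : BundledGraph) ∈ age μ.graph ↔
      Finite V ∧ ∃ h, Represents μ.IsOne G Set.univ h ∧ ∀ v, h v ∈ μ.dom.vertices := by
  have h1 : (⟨V, G⟩ : BundledGraph) ∈ age μ.graph ↔
      (⟨(Set.univ : Set V), G.induce Set.univ⟩ : BundledGraph) ∈ age μ.graph :=
    ⟨mem_age_of_embedding (SimpleGraph.induceUnivIso G).toRelEmbedding,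
      mem_age_of_embedding (SimpleGraph.induceUnivIso G).symm.toRelEmbedding⟩
  rw [h1, induce_mem_age_iff, Set.finite_univ_iff]
  simp [Set.MapsTo]

/-! ### Bounds of an age -/

theorem IsBound.finite {U : Type} {K : SimpleGraph U} {R : BundledGraph}
    (h : IsBound (age K) R) : Finite R.1 := by
  rcases isEmpty_or_nonempty R.1 with h1 | ⟨⟨v⟩⟩
  · infer_instance
  · have h2 : Finite ({v}ᶜ : Set R.1) :=
      (h.2 {v}ᶜ fun e => (e ▸ Set.mem_univ v : v ∈ ({v}ᶜ : Set R.1)) rfl).1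
    have h3 : ({v}ᶜ ∪ {v} : Set R.1).Finite := (Set.toFinite _).union (Set.finite_singleton v)
    rwa [Set.compl_union_self, Set.finite_univ_iff] at h3

theorem IsBound.nonempty {U : Type} {K : SimpleGraph U} {R : BundledGraph}
    (h : IsBound (age K) R) : Nonempty R.1 := by
  by_contra hcon
  rw [not_nonempty_iff] at hcon
  exact h.1 ⟨inferInstance, ⟨⟨⟨fun v => isEmptyElim v, fun v => isEmptyElim v⟩,
    fun {v} => isEmptyElim v⟩⟩⟩

/-- Bounds form an antichain: a non-surjective embedding would place `R` inside a proper induced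
subgraph of `R'`, hence in the age. -/
theorem IsBound.iso_of_embedding {U : Type} {K : SimpleGraph U} {R R' : BundledGraph}
    (h : IsBound (age K) R) (h' : IsBound (age K) R') (e : R.2 ↪g R'.2) :
    Nonempty (R.2 ≃g R'.2) := by
  by_cases hs : Function.Surjective e
  · exact ⟨RelIso.ofSurjective e hs⟩
  · refine absurd (mem_age_of_embedding ?_
      (h'.2 (Set.range e) fun he => hs (Set.range_eq_univ.1 he))) h.1
    exact ⟨⟨fun v => ⟨e v, v, rfl⟩, fun u v he => e.injective (congrArg Subtype.val he)⟩,
      e.map_adj_iff⟩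

/-- A class has finitely many bounds if each of them becomes, after deletion of a vertex, a subgraph
of the graph of a fixed word without long intervals. -/
theorem finite_boundTypes_of_no_long_interval {U : Type} {K : SimpleGraph U} (w : ℤ → Prop) (l : ℕ)
    (hyp : ∀ R : BundledGraph, IsBound (age K) R → ∀ v, ∃ h, Represents w R.2 {v}ᶜ h ∧
      ∀ c : ℤ, ¬ Set.Ico c (c + l) ⊆ h '' {v}ᶜ) :
    (boundTypes (age K)).Finite := by
  by_contra hinf
  let f := Set.Infinite.natEmbedding _ hinf
  have hf : ∀ n, ∃ R, IsBound (age K) R ∧ Quotient.mk isoSetoid R = (f n).1 := fun n => (f n).2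
  choose R hR hRf using hf
  have hne : ∀ n, Nonempty (R n).1 := fun n => (hR n).nonempty
  have hfin : ∀ n, Finite (R n).1 := fun n => (hR n).finite
  let v : ∀ n, (R n).1 := fun n => (hne n).some
  choose h H hl using fun n => hyp (R n) (hR n) (v n)
  obtain ⟨i, j, hij, ⟨e⟩⟩ := exists_lt_embedding w l (fun n => (R n).1) (fun n => (R n).2) v h H hl
  have hiso := (hR i).iso_of_embedding (hR j) e
  have : f i = f j := Subtype.ext (by rw [← hRf i, ← hRf j]; exact Quotient.sound hiso)
  exact hij.ne (f.injective this)

theorem finite_boundTypes_of_finite_domain {μ : Word} {n : ℕ} (hμ : μ.dom = .fin n) :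
    (boundTypes (age μ.graph)).Finite := by
  -- The graph has `n + 1` vertices, one fewer than the excluded interval.
  refine finite_boundTypes_of_no_long_interval μ.IsOne (n + 2) fun R hR v => ?_
  have h1 := hR.2 {v}ᶜ fun e => (e ▸ Set.mem_univ v : v ∈ ({v}ᶜ : Set R.1)) rfl
  obtain ⟨-, h, H, hm⟩ := induce_mem_age_iff.1 h1
  refine ⟨h, H, fun c hc => ?_⟩
  have h2 : ∀ z ∈ Set.Ico c (c + (n + 2 : ℕ)), -1 ≤ z ∧ z < n := by
    intro z hz
    obtain ⟨u, hu, rfl⟩ := hc hz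
    have := hm hu
    rw [hμ] at this
    exact this
  have h3 := h2 c ⟨le_rfl, by omega⟩
  have h4 := h2 (c + (n + 1)) ⟨by omega, by push_cast; omega⟩
  omega

/-! ### Finitely many bounds for periodic words -/

theorem WordDomain.exists_shift {D : WordDomain} (hD : ∀ n, D ≠ .fin n) {p : ℕ} (hp : 0 < p)
    (s : Set ℤ) (hs : s.Finite) : ∃ k : ℤ, ∀ z ∈ s, z + k * p ∈ D.positions := by
  cases D with
  | fin n => exact absurd rfl (hD n)
  | nat =>
    obtain ⟨b, hb⟩ := hs.bddBelow
    refine ⟨|b|, fun z hz => ?_⟩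
    have h1 : |b| * 1 ≤ |b| * p := mul_le_mul_of_nonneg_left (by exact_mod_cast hp) (abs_nonneg b)
    have h2 := neg_abs_le b
    have h3 := hb hz
    simp only [WordDomain.positions, Set.mem_Ici]
    linarith
  | negNat =>
    obtain ⟨b, hb⟩ := hs.bddAbove
    refine ⟨-|b|, fun z hz => ?_⟩
    have h1 : |b| * 1 ≤ |b| * p := mul_le_mul_of_nonneg_left (by exact_mod_cast hp) (abs_nonneg b)
    have h2 := le_abs_self b
    have h3 := hb hz
    simp only [WordDomain.positions, Set.mem_Iic]
    linarith
  | int => exact ⟨0, fun z _ => Set.mem_univ _⟩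

theorem Word.Periodic.exists_extension {μ : Word} (h : μ.Periodic) :
    ∃ (p : ℕ) (w : ℤ → Prop), 0 < p ∧ Function.Periodic w p ∧
      ∀ z ∈ μ.dom.positions, (w z ↔ μ.IsOne z) := by
  obtain ⟨p, hp, hper⟩ := h
  have up : ∀ (n : ℕ) (z : ℤ), z ∈ μ.dom.positions → z + n * p ∈ μ.dom.positions →
      (μ.IsOne (z + n * p) ↔ μ.IsOne z) := by
    intro n
    induction n with
    | zero => simp
    | succ n ih =>
      intro z hz hz'
      have h1 : z + n * p ∈ μ.dom.positions :=
        μ.dom.ordConnected_positions.out hz hz' ⟨le_add_of_nonneg_right (by positivity), by push_cast; nlinarith⟩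
      have e : z + (n + 1 : ℕ) * p = z + n * p + p := by push_cast; ring
      rw [e] at hz' ⊢
      rw [← ih z hz h1, μ.isOne_iff h1, μ.isOne_iff hz', hper _ h1 hz']
  -- The extension is consistent because the domain is an interval: two positions congruent modulo
  -- `p` are joined by steps of length `p` inside it.
  refine ⟨p, fun z => ∃ k : ℤ, μ.IsOne (z + k * p), hp, fun z => propext ?_, fun z hz => ?_⟩
  · constructor
    · rintro ⟨k, hk⟩
      exact ⟨k + 1, by rwa [show z + (k + 1) * p = z + p + k * p by ring]⟩
    · rintro ⟨k, hk⟩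
      exact ⟨k - 1, by rwa [show z + p + (k - 1) * p = z + k * p by ring]⟩
  · refine ⟨fun ⟨k, hk⟩ => ?_, fun h => ⟨0, by simpa using h⟩⟩
    obtain ⟨n, rfl | rfl⟩ := Int.eq_nat_or_neg k
    · exact (up n z hz hk.1).1 hk
    · have h1 := up n _ hk.1 (by simpa using hz)
      rw [show z + -(n : ℤ) * p + n * p = z by ring] at h1
      exact h1.2 hk

theorem finite_boundTypes_of_periodic {μ : Word} (hD : ∀ n, μ.dom ≠ .fin n) (hμ : μ.Periodic)
    (hc : ¬ μ.Constant) : (boundTypes (age μ.graph)).Finite := by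
  obtain ⟨p, w, hp, hw, hwμ⟩ := hμ.exists_extension
  have h1 : ∃ i, w i := by
    by_contra! hcon
    exact hc ⟨0, fun i => (μ.letter_eq_iff i.2 0).2 (by simpa [← hwμ i i.2] using hcon i)⟩
  have h0 : ∃ i, ¬ w i := by
    by_contra! hcon
    exact hc ⟨1, fun i => (μ.letter_eq_iff i.2 1).2 (by simpa [← hwμ i i.2] using hcon i)⟩
  have transfer : ∀ {V : Type} {G : SimpleGraph V} {s : Set V} {h : V → ℤ},
      Set.MapsTo h s μ.dom.vertices → (Represents μ.IsOne G s h ↔ Represents w G s h) := by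
    intro V G s h hm
    refine and_congr_right fun _ => forall₂_congr fun u hu => forall₂_congr fun v hv => ?_
    have : (wordGraph μ.IsOne).Adj (h u) (h v) ↔ (wordGraph w).Adj (h u) (h v) := by
      rcases lt_trichotomy (h u) (h v) with e | e | e
      · rw [wordGraph_adj_of_lt e, wordGraph_adj_of_lt e,
          hwμ _ (WordDomain.mem_positions_of_lt (hm hu) (hm hv) e)]
      · simp [e]
      · rw [SimpleGraph.adj_comm, wordGraph_adj_of_lt e, SimpleGraph.adj_comm,
          wordGraph_adj_of_lt e, hwμ _ (WordDomain.mem_positions_of_lt (hm hv) (hm hu) e)]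
    rw [this]
  refine finite_boundTypes_of_no_long_interval w (3 * p + 13) fun R hR v => ?_
  have hfin := hR.finite
  have hall : ∀ s : Set R.1, s ≠ Set.univ → ∃ h, Represents w R.2 s h := by
    intro s hs
    obtain ⟨-, h, H, hm⟩ := induce_mem_age_iff.1 (hR.2 s hs)
    exact ⟨h, (transfer hm).1 H⟩
  have hno : ¬ ∃ h, Represents w R.2 Set.univ h := by
    rintro ⟨h, H⟩
    -- A multiple of the period moves the finite image into the infinite domain, which would put `R`
    -- in the age.
    obtain ⟨k, hk⟩ := WordDomain.exists_shift hD hp (Set.range h) (Set.finite_range h)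
    have hper : Function.Periodic w (-(k * p)) := (hw.int_mul k).neg
    refine hR.1 (mem_age_iff.2 ⟨hfin, _, (transfer ?_).2 (H.sub_period hper), ?_⟩)
    all_goals
      intro v
      simp only [sub_neg_eq_add]
      try intro _
      exact μ.dom.positions_subset_vertices (hk _ ⟨v, rfl⟩)
  obtain ⟨h, H⟩ := hall {v}ᶜ fun e => (e ▸ Set.mem_univ v : v ∈ ({v}ᶜ : Set R.1)) rfl
  refine ⟨h, H, fun c hsub =>
    not_long_interval_of_periodic hp hw h1 h0 hno hall H (c + 1) fun z hz => hsub ?_⟩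
  simp only [Set.mem_Icc, Set.mem_Ico] at hz ⊢
  push_cast
  omega

/-! ### Non-periodic words: gluing factors -/

theorem Word.UniformlyRecurrent.exists_window {μ : Word} (h : μ.UniformlyRecurrent) (n : ℕ) :
    ∃ m : ℕ, ∀ p q : ℤ, (∀ k : ℕ, k < n → p + k ∈ μ.dom.positions) →
      (∀ k : ℕ, k < m → q + k ∈ μ.dom.positions) →
      ∃ r : ℕ, r + n ≤ m ∧ ∀ k : ℕ, k < n → (μ.IsOne (q + r + k) ↔ μ.IsOne (p + k)) := by
  obtain ⟨m, hm⟩ := h n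
  refine ⟨m, fun p q hp hq => ?_⟩
  obtain ⟨s, t, e⟩ := hm (List.ofFn fun k : Fin n => μ.letter ⟨p + (k : ℕ), hp k k.2⟩)
    (List.ofFn fun k : Fin m => μ.letter ⟨q + (k : ℕ), hq k k.2⟩)
    ⟨p, fun k hk => ⟨hp k (by simpa using hk), by simp⟩⟩ (by simp)
    ⟨q, fun k hk => ⟨hq k (by simpa using hk), by simp⟩⟩ (by simp)
  have hlen := congrArg List.length e
  simp only [List.length_append, List.length_ofFn] at hlen
  refine ⟨s.length, by omega, fun k hk => ?_⟩
  have e1 := congrArg (fun l => l[s.length + k]?) e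
  simp only [List.append_assoc] at e1
  rw [List.getElem?_append_right (by omega), List.getElem?_append_left (by simp; omega),
    List.getElem?_ofFn, List.getElem?_ofFn, dif_pos (by omega), dif_pos (by omega)] at e1
  simp only [Nat.add_sub_cancel_left, Option.some.injEq] at e1
  have h1 := hp k hk
  have h2 := hq (s.length + k) (by omega)
  push_cast at h2
  rw [← add_assoc] at h2
  rw [μ.isOne_iff h1, μ.isOne_iff h2, e1]
  simp only [Nat.cast_add, add_assoc]

theorem WordDomain.exists_long_window {D : WordDomain} (hD : ∀ n, D ≠ .fin n) (m : ℕ) :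
    ∃ q : ℤ, ∀ k : ℤ, 0 ≤ k → k < m → q + k ∈ D.positions := by
  cases D with
  | fin n => exact absurd rfl (hD n)
  | nat => exact ⟨0, fun k hk _ => by simpa [WordDomain.positions] using hk⟩
  | negNat => exact ⟨-m, fun k _ hk => by simp only [WordDomain.positions, Set.mem_Iic]; omega⟩
  | int => exact ⟨0, fun _ _ _ => Set.mem_univ _⟩

theorem Word.periodic_of_finite_domain {μ : Word} {n : ℕ} (hμ : μ.dom = .fin n) : μ.Periodic := by
  refine ⟨n + 1, n.succ_pos, fun i hi hip => ?_⟩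
  exfalso
  rw [hμ] at hi hip
  simp only [WordDomain.positions, Set.mem_Ico] at hi hip
  push_cast at hip
  omega

/-- If factors overlapping in at least `N` letters can always be glued to a factor, then a uniformly
recurrent word is periodic. -/
theorem Word.UniformlyRecurrent.periodic_of_glue {μ : Word} (hμ : μ.UniformlyRecurrent)
    (hD : ∀ n, μ.dom ≠ .fin n) (N : ℕ)
    (glue : ∀ n : ℕ, N ≤ n → ∀ P Q : ℤ, (∀ k : ℕ, k < n + 1 → P + k ∈ μ.dom.positions) →
      (∀ k : ℕ, k < n + 1 → Q + k ∈ μ.dom.positions) →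
      (∀ k : ℕ, k < n → (μ.IsOne (P + 1 + k) ↔ μ.IsOne (Q + k))) →
      ∃ T : ℤ, (∀ k : ℕ, k < n + 2 → T + k ∈ μ.dom.positions) ∧
        (∀ k : ℕ, k < n + 1 → (μ.IsOne (T + k) ↔ μ.IsOne (P + k))) ∧
        (μ.IsOne (T + (n + 1)) ↔ μ.IsOne (Q + n))) : μ.Periodic := by
  -- Gluing consecutive windows of `v` lengthens them by one letter at a time.
  have long : ∀ v : ℕ → Prop, (∀ k : ℕ, ∃ T : ℤ, ∀ t : ℕ, t < N + 1 →
      T + t ∈ μ.dom.positions ∧ (μ.IsOne (T + t) ↔ v (k + t))) → ∀ L k : ℕ, ∃ T : ℤ,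
      ∀ t : ℕ, t < N + 1 + L → T + t ∈ μ.dom.positions ∧ (μ.IsOne (T + t) ↔ v (k + t)) := by
    intro v hv L
    induction L with
    | zero => exact hv
    | succ L ih =>
      intro k
      obtain ⟨P, hP⟩ := ih k
      obtain ⟨Q, hQ⟩ := ih (k + 1)
      obtain ⟨T, h1, h2, h3⟩ := glue (N + L) (by omega) P Q (fun t ht => (hP t (by omega)).1)
        (fun t ht => (hQ t (by omega)).1) (fun t ht => by
          have e1 := (hP (1 + t) (by omega)).2
          have e2 := (hQ t (by omega)).2
          push_cast at e1
          rw [add_assoc P, e1, e2, add_assoc k])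
      refine ⟨T, fun t ht => ⟨h1 t (by omega), ?_⟩⟩
      obtain h4 | rfl : t < N + L + 1 ∨ t = N + L + 1 := by omega
      · rw [h2 t h4, (hP t (by omega)).2]
      · have e2 := (hQ (N + L) (by omega)).2
        push_cast at h3 e2 ⊢
        rw [h3, e2, show k + 1 + (N + L) = k + (N + L + 1) by ring]
  obtain ⟨m, hm⟩ := hμ.exists_window N
  obtain ⟨i, hi⟩ := WordDomain.exists_long_window hD (N + 1 + m)
  obtain ⟨r, hrm, hr⟩ := hm i (i + N + 1) (fun k hk => hi k (by omega) (by push_cast; omega))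
    (fun k hk => by
      rw [show i + N + 1 + k = i + (N + 1 + k : ℤ) by ring]
      exact hi _ (by omega) (by push_cast; omega))
  -- The `N` letters at `i` recur at `i + q`. As `q > N`, every window of length `N + 1` of the
  -- `q`-periodic word `v` can be read in `μ` between `i` and `i + q + N - 1`.
  obtain ⟨q, hq⟩ : ∃ q : ℕ, q = N + 1 + r := ⟨_, rfl⟩
  have hr' : ∀ k : ℕ, k < N → (μ.IsOne (i + (q + k : ℕ)) ↔ μ.IsOne (i + k)) := by
    intro k hk
    rw [← hr k hk, hq]
    push_cast
    ring_nf
  obtain ⟨v, hv⟩ : ∃ v : ℕ → Prop, ∀ k, v k ↔ μ.IsOne (i + (k % q : ℕ)) := ⟨_, fun _ => Iff.rfl⟩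
  have hvi : ∀ s, s < q + N → (μ.IsOne (i + s) ↔ v s) := by
    intro s hs
    rw [hv]
    rcases lt_or_ge s q with h | h
    · rw [Nat.mod_eq_of_lt h]
    · obtain ⟨t, rfl⟩ := Nat.exists_eq_add_of_le h
      rw [hr' t (by omega), Nat.add_mod_left, Nat.mod_eq_of_lt (by omega)]
  have hfac := long v (fun k => ⟨i + (k % q : ℕ), fun t ht => by
    have h1 : k % q < q := Nat.mod_lt _ (by omega)
    have e : i + ((k % q : ℕ) : ℤ) + t = i + (k % q + t : ℕ) := by push_cast; ring
    rw [e]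
    refine ⟨hi _ (by positivity) (by exact_mod_cast (by omega)), ?_⟩
    rw [hvi _ (by omega), hv, hv, Nat.mod_add_mod]⟩)
  obtain ⟨m', hm'⟩ := hμ.exists_window (q + 1)
  obtain ⟨T, hT⟩ := hfac m' 0
  refine ⟨q, by omega, fun z hz hzq => ?_⟩
  -- By recurrence the factor on `z, …, z + q` occurs inside a window of `v`, so its first and last
  -- letters agree.
  obtain ⟨t, htm, ht⟩ := hm' z T
    (fun k hk => μ.dom.ordConnected_positions.out hz hzq ⟨by omega, by omega⟩)
    (fun k hk => (hT k (by omega)).1)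
  have e1 := ht 0 (by omega)
  have e2 := ht q (by omega)
  have e3 := (hT t (by omega)).2
  have e4 := (hT (t + q) (by omega)).2
  push_cast at e1 e4
  rw [← add_assoc] at e4
  rw [add_zero, add_zero, e3, hv] at e1
  rw [e4, hv, ← add_assoc, Nat.add_mod_right] at e2
  rw [μ.letter_eq_iff hz, ← e1, e2, μ.isOne_iff hzq]

theorem Word.UniformlyRecurrent.exists_both_letters {μ : Word} (hμ : μ.UniformlyRecurrent)
    (hper : ¬ μ.Periodic) : ∃ K : ℕ, ∀ i : ℤ, (∀ k : ℕ, k < K → i + k ∈ μ.dom.positions) →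
      (∃ k, i ≤ k ∧ k < i + K ∧ μ.IsOne k) ∧ ∃ k, i ≤ k ∧ k < i + K ∧ ¬ μ.IsOne k := by
  have h1 : ∃ z ∈ μ.dom.positions, μ.IsOne z := by
    by_contra! hcon
    refine hper ⟨1, one_pos, fun i hi hip => ?_⟩
    rw [μ.letter_eq_iff hi, ← μ.isOne_iff hip]
    exact iff_of_false (hcon i hi) (hcon _ hip)
  have h0 : ∃ z ∈ μ.dom.positions, ¬ μ.IsOne z := by
    by_contra! hcon
    refine hper ⟨1, one_pos, fun i hi hip => ?_⟩
    rw [μ.letter_eq_iff hi, ← μ.isOne_iff hip]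
    exact iff_of_true (hcon i hi) (hcon _ hip)
  obtain ⟨K, hK⟩ := hμ.exists_window 1
  obtain ⟨z, hz, hz1⟩ := h1
  obtain ⟨y, hy, hy0⟩ := h0
  refine ⟨K, fun i hi => ⟨?_, ?_⟩⟩
  · obtain ⟨r, hr, e⟩ := hK z i (fun k hk => by
      obtain rfl : k = 0 := by omega
      simpa using hz) hi
    have e1 := e 0 one_pos
    simp only [Nat.cast_zero, add_zero] at e1
    exact ⟨i + r, by omega, by omega, e1.2 hz1⟩
  · obtain ⟨r, hr, e⟩ := hK y i (fun k hk => by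
      obtain rfl : k = 0 := by omega
      simpa using hy) hi
    have e1 := e 0 one_pos
    simp only [Nat.cast_zero, add_zero] at e1
    exact ⟨i + r, by omega, by omega, fun h => hy0 (e1.1 h)⟩

theorem Word.UniformlyRecurrent.exists_locally_represented {μ : Word} (hμ : μ.UniformlyRecurrent)
    (hper : ¬ μ.Periodic) (N : ℕ) : ∃ (x : ℤ → Prop) (c e : ℤ),
      (∀ s ⊆ Set.Icc c e, s.ncard ≤ N → ∃ h, Represents μ.IsOne (wordGraph x) s h ∧
        Set.MapsTo h s μ.dom.vertices) ∧
      ¬ ∃ h, Represents μ.IsOne (wordGraph x) (Set.Icc c e) h ∧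
        Set.MapsTo h (Set.Icc c e) μ.dom.vertices := by
  have hD : ∀ n, μ.dom ≠ .fin n := fun n e => hper (Word.periodic_of_finite_domain e)
  obtain ⟨K, hK⟩ := hμ.exists_both_letters hper
  have hbad := mt (hμ.periodic_of_glue hD N) hper
  push Not at hbad
  obtain ⟨n, hNn, P, Q, hP, hQ, hPQ, hbad⟩ := hbad
  obtain ⟨m, hm⟩ := hμ.exists_window (n + 1)
  obtain ⟨q, hq⟩ := WordDomain.exists_long_window hD (3 * K + 20 + 2 * m)
  -- The `3 * K + 20` letters in front are the run-in that rigidity needs. The second factor is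
  -- sought past the window of the first, so that the later shift goes to the right.
  obtain ⟨r, hrm, hr⟩ := hm P (q + (3 * K + 20)) hP (fun k hk => by
    rw [add_assoc]
    exact hq _ (by positivity) (by push_cast; omega))
  obtain ⟨r', hrm', hr'⟩ := hm Q (q + (3 * K + 20 + m)) hQ (fun k hk => by
    rw [add_assoc]
    exact hq _ (by positivity) (by push_cast; omega))
  obtain ⟨P', hP'⟩ : ∃ P' : ℤ, P' = q + (3 * K + 20) + r := ⟨_, rfl⟩
  obtain ⟨Q', hQ'⟩ : ∃ Q' : ℤ, Q' = q + (3 * K + 20 + m) + r' := ⟨_, rfl⟩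
  rw [← hP'] at hr
  rw [← hQ'] at hr'
  obtain ⟨e, he⟩ : ∃ e : ℤ, e = P' + n + 1 := ⟨_, rfl⟩
  obtain ⟨c, hc⟩ : ∃ c : ℤ, c = P' - (3 * K + 20) := ⟨_, rfl⟩
  have hpos : ∀ z, c ≤ z → z < e → z ∈ μ.dom.positions := fun z h1 h2 => by
    rw [← add_sub_cancel q z]
    exact hq _ (by omega) (by push_cast; omega)
  have hpos' : ∀ z, Q' ≤ z → z ≤ Q' + n → z ∈ μ.dom.positions := fun z h1 h2 => by
    rw [← add_sub_cancel q z]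
    exact hq _ (by omega) (by push_cast; omega)
  -- On `P', …, e` the word `x` reads the forbidden gluing; only its last letter is prescribed anew.
  obtain ⟨x, hx⟩ : ∃ x : ℤ → Prop, ∀ z, x z ↔ if z = e then μ.IsOne (Q + n) else μ.IsOne z :=
    ⟨_, fun _ => Iff.rfl⟩
  have hxlt : ∀ z, z < e → (x z ↔ μ.IsOne z) := fun z hz => by rw [hx, if_neg hz.ne]
  have hxe : x e ↔ μ.IsOne (Q + n) := by rw [hx, if_pos rfl]
  have hxshift : ∀ z, P' < z → z ≤ e → (μ.IsOne (z + (Q' - P' - 1)) ↔ x z) := by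
    intro z h1 h2
    obtain ⟨j, hj⟩ := Int.eq_ofNat_of_zero_le (show 0 ≤ z - P' - 1 by omega)
    obtain rfl : z = P' + (j + 1 : ℕ) := by push_cast; omega
    have e1 : P' + (j + 1 : ℕ) + (Q' - P' - 1) = Q' + j := by push_cast; ring
    rw [e1, hr' j (by omega)]
    obtain h3 | rfl : j < n ∨ j = n := by omega
    · have e2 := hPQ j h3
      rw [hxlt _ (by omega), hr (j + 1) (by omega), ← e2]
      push_cast
      ring_nf
    · have : P' + (j + 1 : ℕ) = e := by push_cast; omega
      rw [this, hxe]
  refine ⟨x, c, e, fun s hs hcard => ?_, ?_⟩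
  -- There are `n + 2 > N` vertices from `P'` to `e`, so one is missing from `s`. The part before it
  -- stays in place; the part after it is read in the occurrence of the second factor at `Q'`.
  · obtain ⟨i, hi1, hi2, his⟩ : ∃ i, P' ≤ i ∧ i ≤ e ∧ i ∉ s := by
      by_contra! hcon
      have hsub : (Finset.Icc P' e : Set ℤ) ⊆ s := fun z hz => by
        rw [Finset.coe_Icc] at hz
        exact hcon z hz.1 hz.2
      have h1 := Set.ncard_le_ncard hsub ((Set.finite_Icc c e).subset hs)
      rw [Set.ncard_coe_finset, Int.card_Icc] at h1
      omega
    have hne : ∀ z ∈ s, z ≠ i := fun z hz h => his (h ▸ hz)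
    have mixed : ∀ u ∈ s, ∀ v ∈ s, u < i → i < v →
        ((wordGraph μ.IsOne).Adj u (v + (Q' - P' - 1)) ↔ (wordGraph x).Adj u v) := by
      intro u hu v hv hui hvi
      rw [wordGraph_adj_of_add_one_lt (by omega), wordGraph_adj_of_add_one_lt (by omega),
        hxshift v (by omega) (hs hv).2]
    refine ⟨fun z => if z < i then z else z + (Q' - P' - 1), ⟨fun u hu v hv huv => ?_,
      fun u hu v hv => ?_⟩, fun z hz => μ.dom.positions_subset_vertices ?_⟩
    · simp only [] at huv
      split_ifs at huv <;> omega
    · have hu' := hne u hu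
      have hv' := hne v hv
      simp only []
      split_ifs with h1 h2 h2
      · exact wordGraph_adj_congr rfl (hxlt u (by omega)).symm (hxlt v (by omega)).symm
      · exact mixed u hu v hv h1 (by omega)
      · rw [SimpleGraph.adj_comm, mixed v hv u hu h2 (by omega), SimpleGraph.adj_comm]
      · exact wordGraph_adj_congr (by ring) (hxshift u (by omega) (hs hu).2)
          (hxshift v (by omega) (hs hv).2)
    · have h3 := hs hz
      have h4 := hne z hz
      simp only []
      split_ifs with h1
      · exact hpos z h3.1 (by omega)
      · exact hpos' _ (by omega) (by have := h3.2; omega)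
  · rintro ⟨h, H, hm⟩
    obtain ⟨t1, t2⟩ := H.translation (K := K) (fun i hi hiK => by
      obtain ⟨⟨k, a, b, hk⟩, l, a', b', hl⟩ := hK i fun k hk => hpos _ (by omega) (by omega)
      exact ⟨⟨k, a, b, (hxlt k (by omega)).2 hk⟩, l, a', b',
        fun h => hl ((hxlt l (by omega)).1 h)⟩) (by omega)
    have t3 : ∀ k : ℕ, k < n + 2 → h e - (n + 1) + k = h (P' + k) := fun k hk => by
      rw [t1 (P' + k) (by omega) (by omega)]
      omega
    -- The translated copy of `P', …, e` would be an occurrence in `μ` of the gluing that `hbad`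
    -- rules out.
    have hlast : μ.IsOne (h e - (n + 1) + (n + 1)) ↔ μ.IsOne (Q + n) := by
      rw [sub_add_cancel, t2 e (by omega) le_rfl, hxe]
    have := hbad (h e - (n + 1)) (fun k hk => ?_) (fun k hk => ?_)
    · tauto
    · rw [t3 k hk]
      have e1 := t1 (P' + k) (by omega) (by omega)
      have e2 := t1 (P' + k - 1) (by omega) (by omega)
      exact WordDomain.mem_positions_of_lt (hm (⟨by omega, by omega⟩ : P' + k - 1 ∈ Set.Icc c e))
        (hm ⟨by omega, by omega⟩) (by omega)
    · rw [t3 k (by omega), t2 _ (by omega) (by omega), hxlt _ (by omega), hr k hk]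

/-! ### Large bounds and the conclusion -/

/-- A graph outside an age all of whose small induced subgraphs belong to the age contains a large
bound. -/
theorem exists_large_bound {U V : Type} {K : SimpleGraph U} {G : SimpleGraph V} {s : Set V}
    (hs : s.Finite) (N : ℕ) (hG : (⟨s, G.induce s⟩ : BundledGraph) ∉ age K)
    (hloc : ∀ t ⊆ s, t.ncard ≤ N → (⟨t, G.induce t⟩ : BundledGraph) ∈ age K) :
    ∃ R, IsBound (age K) R ∧ N < Nat.card R.1 := by
  have hfin : {t | t ⊆ s ∧ (⟨t, G.induce t⟩ : BundledGraph) ∉ age K}.Finite :=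
    hs.finite_subsets.subset fun t ht => ht.1
  obtain ⟨t, ⟨⟨hts, ht⟩, hmin⟩⟩ := hfin.exists_minimal ⟨s, subset_rfl, hG⟩
  refine ⟨⟨t, G.induce t⟩, ⟨ht, fun r hr => ?_⟩, ?_⟩
  · by_contra hcon
    have hrt : Subtype.val '' r ⊆ t := by
      rintro _ ⟨v, -, rfl⟩
      exact v.2
    have hr' : t ⊆ Subtype.val '' r := by
      refine hmin ⟨hrt.trans hts, fun h => hcon (mem_age_of_embedding ?_ h)⟩ hrt
      exact ⟨⟨fun v => ⟨v.1.1, v.1, v.2, rfl⟩, fun u v h =>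
        Subtype.ext (Subtype.ext (Subtype.mk.inj h))⟩, Iff.rfl⟩
    refine hr (Set.eq_univ_of_forall fun v => ?_)
    obtain ⟨u, hu, huv⟩ := hr' v.2
    rwa [← Subtype.ext huv]
  · by_contra! hcon
    exact ht (hloc t hts hcon)

theorem infinite_boundTypes {U : Type} {K : SimpleGraph U}
    (h : ∀ N : ℕ, ∃ R, IsBound (age K) R ∧ N < Nat.card R.1) : (boundTypes (age K)).Infinite := by
  intro hfin
  obtain ⟨N, hN⟩ := (hfin.image fun q => Nat.card q.out.1).bddAbove
  obtain ⟨R, hR, hcard⟩ := h N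
  have h1 := hN ⟨_, ⟨R, hR, rfl⟩, rfl⟩
  obtain ⟨e⟩ : Nonempty ((Quotient.mk isoSetoid R).out.2 ≃g R.2) :=
    Quotient.exact (Quotient.out_eq (Quotient.mk isoSetoid R))
  simp only [Nat.card_congr e.toEquiv] at h1
  omega

end ZeroOne

theorem mainTheorem4 (μ : ZeroOne.Word) (hμ : μ.UniformlyRecurrent) :
    (¬ μ.Periodic → (ZeroOne.boundTypes (ZeroOne.age μ.graph)).Infinite) ∧
    (μ.Periodic → ¬ μ.Constant → (ZeroOne.boundTypes (ZeroOne.age μ.graph)).Finite) := by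
  refine ⟨fun hper => ZeroOne.infinite_boundTypes fun N => ?_, fun hper hc => ?_⟩
  · obtain ⟨x, c, e, h1, h2⟩ := hμ.exists_locally_represented hper N
    refine ZeroOne.exists_large_bound (G := ZeroOne.wordGraph x) (Set.finite_Icc c e) N
      (fun h => h2 (ZeroOne.induce_mem_age_iff.1 h).2) fun t ht hcard =>
        ZeroOne.induce_mem_age_iff.2 ⟨(Set.finite_Icc c e).subset ht, h1 t ht hcard⟩
  · by_cases hD : ∀ n, μ.dom ≠ .fin n
    · exact ZeroOne.finite_boundTypes_of_periodic hD hper hc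
    · push Not at hD
      obtain ⟨n, hn⟩ := hD
      exact ZeroOne.finite_boundTypes_of_finite_domain hn
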